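/- Let $R$ be a commutative noetherian ring; all modules are finitely generated, and $n\ge 0$ is an integer. A module $C$ is *semidualizing* if the homothety map $R\to\operatorname{Hom}_R(C,C)$ is an isomorphism and $\operatorname{Ext}^i_R(C,C)=0$ for all $i>0$. For a module $C$ we use the following terminology. - $M$ is *$n$-$C$-torsionfree* if $\operatorname{Ext}^i_R(\operatorname{Tr}_CM,C)=0$ for all $1\le i\le n$, where $\operatorname{Tr}_CM$ is the cokernel of $\operatorname{Hom}_R(P_0,C)\to\operatorname{Hom}_R(P_1,C)$ for a presentation $P_1\to P_0\to M\to 0$ by projective modules. (For semidualizing $C$ the module $\operatorname{Tr}_CM$ is unique up to direct summands of finite direct sums of copies of $C$, so the choice of the presentation does not matter.) - $M$ is *$n$-$C$-syzygy* if there is an exact sequence $0\to M\to P_C^1\to P_C^2\to\cdots\to P_C^n$ in which each $P_C^i$ is a direct summand of a finite direct sum of copies of $C$ (no condition if $n=0$). - $R$ satisfies $(S_n)$ if $\operatorname{depth}R_{\mathfrak p}\ge\min\{n,\dim R_{\mathfrak p}\}$ for every prime ideal $\mathfrak p$ of $R$. - For an integer $k$, $R$ satisfies $(G_k^C)$ if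 $C_{\mathfrak p}$ has finite injective dimension over $R_{\mathfrak p}$ for every prime ideal $\mathfrak p$ of $R$ of height at most $k$. Let $C$ and $C'$ be semidualizing $R$-modules, and assume that $R$ satisfies $(S_n)$, $(G_{n-1}^C)$ and $(G_{n-1}^{C'})$. Then the following conditions are equivalent for an $R$-module $M$: 1. $M$ is $n$-$C$-torsionfree; 2. $M$ is $n$-$C'$-torsionfree; 3. $M$ is $n$-$C$-syzygy; 4. $M$ is $n$-$C'$-syzygy. -/

import Mathlib

universe u

namespace SemidualizingTorsion

open CategoryTheory

section

variable (R : Type u) [CommRing R]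

/-- `Ext^i_R(X, Y) = 0`. -/
def ExtVanishes (X Y : Type u) [AddCommGroup X] [Module R X] [AddCommGroup Y] [Module R Y]
    (i : ℕ) : Prop :=
  Subsingleton (Abelian.Ext (ModuleCat.of R X) (ModuleCat.of R Y) i)

/-- A (finitely generated) module `C` is semidualizing if the homothety map `R → Hom_R(C, C)` is
an isomorphism and `Ext^i_R(C, C) = 0` for all `i > 0`. -/
structure IsSemidualizing (C : Type u) [AddCommGroup C] [Module R C] : Prop where
  finite : Module.Finite R C
  homothety_bijective : Function.Bijective (LinearMap.lsmul R C : R → C →ₗ[R] C)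
  ext_vanishes : ∀ i : ℕ, 0 < i → ExtVanishes R C C i

/-- The beginning `P₁ → P₀ → M → 0` of a resolution of `M` by finitely generated projective
modules. -/
structure ProjPresentation (M : Type u) [AddCommGroup M] [Module R M] where
  P₁ : ModuleCat.{u} R
  P₀ : ModuleCat.{u} R
  finite₁ : Module.Finite R P₁
  finite₀ : Module.Finite R P₀
  projective₁ : Module.Projective R P₁
  projective₀ : Module.Projective R P₀
  d : P₁ →ₗ[R] P₀
  ε : P₀ →ₗ[R] M
  exact : Function.Exact d ε
  surjective : Function.Surjective ε

variable {R} in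
/-- The `C`-transpose of `M` computed from a presentation: the cokernel of
`Hom_R(P₀, C) → Hom_R(P₁, C)`. -/
abbrev ProjPresentation.transpose {M : Type u} [AddCommGroup M] [Module R M]
    (π : ProjPresentation R M) (C : Type u) [AddCommGroup C] [Module R C] : Type u :=
  (π.P₁ →ₗ[R] C) ⧸ LinearMap.range (π.d.lcomp R C : (π.P₀ →ₗ[R] C) →ₗ[R] (π.P₁ →ₗ[R] C))

/-- `M` is `n`-`C`-torsionfree: `Ext^i_R(Tr_C M, C) = 0` for `1 ≤ i ≤ n`. The transpose is unique
up to direct summands of finite direct sums of copies of `C`, so that any presentation may be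
used when `C` is semidualizing. -/
def IsTorsionfree (n : ℕ) (C M : Type u) [AddCommGroup C] [Module R C]
    [AddCommGroup M] [Module R M] : Prop :=
  ∃ π : ProjPresentation R M, ∀ i : ℕ, 1 ≤ i → i ≤ n → ExtVanishes R (π.transpose C) C i

/-- `P` is a direct summand of a finite direct sum of copies of `C`. -/
def IsSummandOfCopies (C P : Type u) [AddCommGroup C] [Module R C]
    [AddCommGroup P] [Module R P] : Prop :=
  ∃ (k : ℕ) (s : P →ₗ[R] (Fin k → C)) (r : (Fin k → C) →ₗ[R] P), r ∘ₗ s = LinearMap.id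

/-- `M` is `n`-`C`-syzygy: there is an exact sequence `0 → M → X₁ → ⋯ → Xₙ` with every `Xᵢ` a
direct summand of a finite direct sum of copies of `C`. Here `X₀` is `M` up to isomorphism, the
entries of the sequence beyond `Xₙ` play no role, and nothing is required for `n = 0`. -/
def IsSyzygy (n : ℕ) (C M : Type u) [AddCommGroup C] [Module R C]
    [AddCommGroup M] [Module R M] : Prop :=
  ∃ (X : ℕ → ModuleCat.{u} R) (d : ∀ i, X i →ₗ[R] X (i + 1)),
    Nonempty (M ≃ₗ[R] X 0) ∧
    (∀ i, 1 ≤ i → i ≤ n → IsSummandOfCopies R C (X i)) ∧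
    (1 ≤ n → Function.Injective (d 0)) ∧
    (∀ i, i + 1 < n → Function.Exact (d i) (d (i + 1)))

/-- Depth of a finitely generated module over a (noetherian) local ring: the supremum of the
lengths of regular sequences in the maximal ideal. Weak regularity is regularity for nonzero
finitely generated modules, and gives the zero module depth `∞`. -/
noncomputable def depth [IsLocalRing R] (N : Type u) [AddCommGroup N] [Module R N] : ℕ∞ :=
  ⨆ (rs : List R) (_ : (∀ r ∈ rs, r ∈ IsLocalRing.maximalIdeal R) ∧
    RingTheory.Sequence.IsWeaklyRegular N rs), (rs.length : ℕ∞)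

/-- Serre's condition `(S_n)` for the ring `R`: `depth R_𝔭 ≥ min {n, dim R_𝔭}` for all primes. -/
def SatisfiesS (n : ℕ) : Prop :=
  ∀ (p : Ideal R) [p.IsPrime],
    min (n : WithBot ℕ∞) (ringKrullDim (Localization.AtPrime p)) ≤
      (depth (Localization.AtPrime p) (Localization.AtPrime p) : WithBot ℕ∞)

/-- The condition `(G_k^C)`: `C_𝔭` has finite injective dimension over `R_𝔭` for every prime `𝔭`
of height at most `k`. The index is an integer, and the condition is empty for `k < 0`. -/
def SatisfiesG (k : ℤ) (C : Type u) [AddCommGroup C] [Module R C] : Prop :=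
  ∀ (p : Ideal R) [p.IsPrime] (h : ℕ), p.height = (h : ℕ∞) → (h : ℤ) ≤ k →
    injectiveDimension (ModuleCat.of (Localization.AtPrime p)
      (LocalizedModule p.primeCompl C)) < ⊤

end

end SemidualizingTorsion

/- A `C`-syzygy of order `n` is at least as deep as `C`, and a semidualizing module is as deep as
`R`, so every `R`-regular sequence of length at most `n` is regular on it. This condition on `M` no
longer mentions `C`, and it implies that `M` is `n`-`C`-torsionfree: let `p` be an associated prime
of the first nonzero `Ext^i(Tr_C M, C)` with `1 ≤ i ≤ n`. If `ht p ≥ i`, then `p` contains a regular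
sequence of length `i`, and dimension shifting along `Hom(P₀, C) → Hom(P₁, C) → Tr_C M → 0`, whose
`C`-dual is `P₁ → P₀`, turns an element of `Ext^i(Tr_C M, C)` killed by `p` into one of
`Ext^(i-1)(R/p, M) = 0`. If `ht p < i`, then `R_p` is Cohen–Macaulay and `C_p` has finite injective
dimension, so `Ext` into `C_p` vanishes on the maximal Cohen–Macaulay module `M_p`; hence
`(Tr_C M)_p` is a `C_p`-syzygy of order `dim R_p`, thus also maximal Cohen–Macaulay, and
`Ext^i(Tr_C M, C)_p = 0`, a contradiction. -/

namespace SemidualizingTorsion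

open CategoryTheory Abelian RingTheory.Sequence IsLocalRing
open scoped Pointwise

variable {R : Type u} [CommRing R]

/-- The sequence `0 → A → B → D → 0` of linear maps is exact. -/
structure IsShortExact {A B D : Type u} [AddCommGroup A] [Module R A] [AddCommGroup B] [Module R B]
    [AddCommGroup D] [Module R D] (f : A →ₗ[R] B) (g : B →ₗ[R] D) : Prop where
  injective : Function.Injective f
  exact : Function.Exact f g
  surjective : Function.Surjective g

section Ext

variable {A B D Y : Type u} [AddCommGroup A] [Module R A] [AddCommGroup B] [Module R B]
  [AddCommGroup D] [Module R D] [AddCommGroup Y] [Module R Y]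

lemma isShortExact_mkQ_range {f : A →ₗ[R] B} (hf : Function.Injective f) :
    IsShortExact f (LinearMap.range f).mkQ where
  injective := hf
  exact := LinearMap.exact_map_mkQ_range f
  surjective := Submodule.mkQ_surjective _

lemma isShortExact_subtype_ker {g : B →ₗ[R] D} (hg : Function.Surjective g) :
    IsShortExact (LinearMap.ker g).subtype g where
  injective := Submodule.subtype_injective _
  exact := g.exact_subtype_ker_map
  surjective := hg

lemma isShortExact_subtype_range {f : A →ₗ[R] B} {g : B →ₗ[R] D} (h : Function.Exact f g)
    (hg : Function.Surjective g) : IsShortExact (LinearMap.range f).subtype g where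
  injective := Submodule.subtype_injective _
  exact := LinearMap.exact_iff.mpr (by rw [h.linearMap_ker_eq, Submodule.range_subtype])
  surjective := hg

lemma isShortExact_lsmul_mkQ {x : R} (hx : IsSMulRegular A x) :
    IsShortExact (LinearMap.lsmul R A x) (x • ⊤ : Submodule R A).mkQ where
  injective := hx
  exact := LinearMap.exact_lsmul_mkQ_smul_top A x
  surjective := Submodule.mkQ_surjective _

lemma isShortExact_inl_snd : IsShortExact (LinearMap.inl R A B) (LinearMap.snd R A B) where
  injective := LinearMap.inl_injective
  exact := Function.Exact.inl_snd
  surjective := LinearMap.snd_surjective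

lemma ExtVanishes.eq_zero {i : ℕ} (h : ExtVanishes R A B i)
    (x : Ext (ModuleCat.of R A) (ModuleCat.of R B) i) : x = 0 :=
  h.elim _ _

lemma extVanishes_of_forall_eq_zero {i : ℕ}
    (h : ∀ x : Ext (ModuleCat.of R A) (ModuleCat.of R B) i, x = 0) : ExtVanishes R A B i :=
  subsingleton_of_forall_eq 0 h

lemma extVanishes_zero_iff : ExtVanishes R A B 0 ↔ Subsingleton (A →ₗ[R] B) :=
  (Ext.addEquiv₀.trans ModuleCat.homAddEquiv).toEquiv.subsingleton_congr

lemma extVanishes_of_projective [Module.Projective R A] {i : ℕ} (hi : 0 < i) :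
    ExtVanishes R A B i := by
  obtain ⟨j, rfl⟩ := Nat.exists_eq_succ_of_ne_zero hi.ne'
  have : Projective (ModuleCat.of R A) := ModuleCat.projective_of_categoryTheory_projective _
  exact Ext.subsingleton_of_projective _ _ j

lemma ExtVanishes.of_retract_left {s : A →ₗ[R] B} {r : B →ₗ[R] A} (hrs : r ∘ₗ s = LinearMap.id)
    {i : ℕ} (hB : ExtVanishes R B Y i) : ExtVanishes R A Y i := by
  have h : ModuleCat.ofHom s ≫ ModuleCat.ofHom r = 𝟙 _ := by
    rw [← ModuleCat.ofHom_comp, hrs]; rfl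
  refine extVanishes_of_forall_eq_zero fun x => ?_
  rw [← Ext.mk₀_id_comp x, ← h, ← Ext.mk₀_comp_mk₀_assoc, hB.eq_zero ((Ext.mk₀ _).comp x _),
    Ext.comp_zero]

lemma ExtVanishes.of_retract_right {s : A →ₗ[R] B} {r : B →ₗ[R] A} (hrs : r ∘ₗ s = LinearMap.id)
    {i : ℕ} (hB : ExtVanishes R Y B i) : ExtVanishes R Y A i := by
  have h : ModuleCat.ofHom s ≫ ModuleCat.ofHom r = 𝟙 _ := by
    rw [← ModuleCat.ofHom_comp, hrs]; rfl
  refine extVanishes_of_forall_eq_zero fun x => ?_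
  rw [← Ext.comp_mk₀_id x, ← h, ← Ext.mk₀_comp_mk₀, ← Ext.comp_assoc_of_second_deg_zero,
    hB.eq_zero (x.comp (Ext.mk₀ _) _), Ext.zero_comp]

lemma ExtVanishes.of_equiv_left (e : A ≃ₗ[R] B) {i : ℕ} (hB : ExtVanishes R B Y i) :
    ExtVanishes R A Y i :=
  hB.of_retract_left e.symm_comp

lemma ExtVanishes.of_equiv_right (e : A ≃ₗ[R] B) {i : ℕ} (hB : ExtVanishes R Y B i) :
    ExtVanishes R Y A i :=
  hB.of_retract_right e.symm_comp

lemma extVanishes_of_subsingleton [Subsingleton A] (i : ℕ) : ExtVanishes R A Y i := by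
  refine extVanishes_of_forall_eq_zero fun x => ?_
  rw [← Ext.mk₀_id_comp x, (ModuleCat.isZero_of_subsingleton (ModuleCat.of R A)).eq_of_src (𝟙 _) 0,
    Ext.mk₀_zero, Ext.zero_comp]

namespace IsShortExact

variable {f : A →ₗ[R] B} {g : B →ₗ[R] D}

/-- The short complex of modules attached to a short exact sequence of linear maps. -/
abbrev shortComplex (h : IsShortExact f g) : ShortComplex (ModuleCat.{u} R) :=
  .mk (ModuleCat.ofHom f) (ModuleCat.ofHom g) <| by
    rw [← ModuleCat.ofHom_comp, h.exact.linearMap_comp_eq_zero, ModuleCat.ofHom_zero]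

lemma shortExact (h : IsShortExact f g) : h.shortComplex.ShortExact where
  exact := (ShortComplex.ShortExact.moduleCat_exact_iff_function_exact _).mpr h.exact
  mono_f := (ModuleCat.mono_iff_injective _).mpr h.injective
  epi_g := (ModuleCat.epi_iff_surjective _).mpr h.surjective

lemma extVanishes_contravariant₁ (h : IsShortExact f g) {i : ℕ} (hB : ExtVanishes R B Y i)
    (hD : ExtVanishes R D Y (i + 1)) : ExtVanishes R A Y i := by
  refine extVanishes_of_forall_eq_zero fun x => ?_
  obtain ⟨y, rfl⟩ := Ext.contravariant_sequence_exact₁ h.shortExact _ x (add_comm 1 i)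
    (hD.eq_zero _)
  rw [hB.eq_zero y, Ext.comp_zero]

lemma extVanishes_contravariant₂ (h : IsShortExact f g) {i : ℕ} (hA : ExtVanishes R A Y i)
    (hD : ExtVanishes R D Y i) : ExtVanishes R B Y i := by
  refine extVanishes_of_forall_eq_zero fun x => ?_
  obtain ⟨y, rfl⟩ := Ext.contravariant_sequence_exact₂ h.shortExact _ x (hA.eq_zero _)
  rw [hD.eq_zero y, Ext.comp_zero]

lemma extVanishes_contravariant₃ (h : IsShortExact f g) {i : ℕ} (hA : ExtVanishes R A Y i)
    (hB : ExtVanishes R B Y (i + 1)) : ExtVanishes R D Y (i + 1) := by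
  refine extVanishes_of_forall_eq_zero fun x => ?_
  obtain ⟨y, rfl⟩ := Ext.contravariant_sequence_exact₃ h.shortExact _ x (hB.eq_zero _)
    (add_comm 1 i)
  rw [hA.eq_zero y, Ext.comp_zero]

lemma extVanishes_covariant₃ (h : IsShortExact f g) {i : ℕ} (hB : ExtVanishes R Y B i)
    (hA : ExtVanishes R Y A (i + 1)) : ExtVanishes R Y D i := by
  refine extVanishes_of_forall_eq_zero fun x => ?_
  obtain ⟨y, rfl⟩ := Ext.covariant_sequence_exact₃ _ h.shortExact x rfl (hA.eq_zero _)
  rw [hB.eq_zero y, Ext.zero_comp]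

lemma exists_lift (h : IsShortExact f g) (hA : ExtVanishes R Y A 1) (φ : Y →ₗ[R] D) :
    ∃ ψ : Y →ₗ[R] B, g ∘ₗ ψ = φ := by
  obtain ⟨y, hy⟩ := Ext.covariant_sequence_exact₃ (ModuleCat.of R Y) h.shortExact
    (Ext.mk₀ (ModuleCat.ofHom φ)) rfl (hA.eq_zero _)
  obtain ⟨y, rfl⟩ := (Ext.mk₀_bijective _ _).2 y
  rw [Ext.mk₀_comp_mk₀] at hy
  exact ⟨y.hom, congrArg ModuleCat.Hom.hom ((Ext.mk₀_bijective _ _).1 hy)⟩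

variable (Y) in
/-- The connecting map `Ext^i(A, Y) → Ext^{i+1}(D, Y)` of `0 → A → B → D → 0`. -/
noncomputable abbrev extConnecting (h : IsShortExact f g) (i : ℕ) :
    Ext (ModuleCat.of R A) (ModuleCat.of R Y) i →ₗ[R]
      Ext (ModuleCat.of R D) (ModuleCat.of R Y) (i + 1) :=
  h.shortExact.extClass.precompOfLinear R _ (add_comm 1 i)

lemma extConnecting_surjective (h : IsShortExact f g) {i : ℕ} (hB : ExtVanishes R B Y (i + 1)) :
    Function.Surjective (h.extConnecting Y i) := fun x =>
  Ext.contravariant_sequence_exact₃ h.shortExact _ x (hB.eq_zero _) (add_comm 1 i)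

lemma extConnecting_injective (h : IsShortExact f g) {i : ℕ} (hB : ExtVanishes R B Y i) :
    Function.Injective (h.extConnecting Y i) := by
  refine (injective_iff_map_eq_zero _).mpr fun x hx => ?_
  obtain ⟨y, rfl⟩ := Ext.contravariant_sequence_exact₁ h.shortExact _ x (add_comm 1 i) hx
  rw [hB.eq_zero y, Ext.comp_zero]

variable (Y) in
/-- The connecting map `Hom(A, Y) → Ext^1(D, Y)` of `0 → A → B → D → 0`. -/
noncomputable def homConnecting (h : IsShortExact f g) :
    (A →ₗ[R] Y) →ₗ[R] Ext (ModuleCat.of R D) (ModuleCat.of R Y) 1 :=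
  h.extConnecting Y 0 ∘ₗ (Ext.linearEquiv₀.trans ModuleCat.homLinearEquiv).symm.toLinearMap

lemma homConnecting_apply (h : IsShortExact f g) (φ : A →ₗ[R] Y) :
    h.homConnecting Y φ =
      h.shortExact.extClass.comp (Ext.mk₀ (ModuleCat.ofHom φ)) (add_comm 1 0) :=
  rfl

lemma homConnecting_eq_zero_iff (h : IsShortExact f g) {φ : A →ₗ[R] Y} :
    h.homConnecting Y φ = 0 ↔ ∃ ψ : B →ₗ[R] Y, ψ ∘ₗ f = φ := by
  rw [homConnecting_apply]
  constructor
  · intro hφ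
    obtain ⟨y, hy⟩ := Ext.contravariant_sequence_exact₁ h.shortExact _ _ (add_comm 1 0) hφ
    obtain ⟨y, rfl⟩ := (Ext.mk₀_bijective _ _).2 y
    rw [Ext.mk₀_comp_mk₀] at hy
    exact ⟨y.hom, congrArg ModuleCat.Hom.hom ((Ext.mk₀_bijective _ _).1 hy)⟩
  · rintro ⟨ψ, rfl⟩
    rw [ModuleCat.ofHom_comp, ← Ext.mk₀_comp_mk₀,
      ← Ext.comp_assoc _ _ _ (add_zero 1) (zero_add 0) (by simp)]
    exact (congrArg (Ext.comp · _ _) h.shortExact.extClass_comp).trans (Ext.zero_comp ..)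

lemma homConnecting_surjective (h : IsShortExact f g) (hB : ExtVanishes R B Y 1) :
    Function.Surjective (h.homConnecting Y) :=
  (h.extConnecting_surjective hB).comp (LinearEquiv.surjective _)

lemma exists_extension (h : IsShortExact f g) (hD : ExtVanishes R D Y 1) (φ : A →ₗ[R] Y) :
    ∃ ψ : B →ₗ[R] Y, ψ ∘ₗ f = φ :=
  h.homConnecting_eq_zero_iff.mp (hD.eq_zero _)

end IsShortExact

lemma ExtVanishes.pi_left {i : ℕ} (h : ExtVanishes R A Y i) (k : ℕ) :
    ExtVanishes R (Fin k → A) Y i := by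
  induction k with
  | zero => exact extVanishes_of_subsingleton i
  | succ k ih =>
    exact .of_equiv_left (Fin.consLinearEquiv R fun _ => A).symm
      (isShortExact_inl_snd.extVanishes_contravariant₂ h ih)

lemma IsSummandOfCopies.extVanishes_left (hB : IsSummandOfCopies R A B) {i : ℕ}
    (h : ExtVanishes R A Y i) : ExtVanishes R B Y i := by
  obtain ⟨k, s, r, hrs⟩ := hB
  exact .of_retract_left hrs (h.pi_left k)

lemma isSummandOfCopies_hom [Module.Finite R A] [Module.Projective R A] :
    IsSummandOfCopies R B (A →ₗ[R] B) := by
  obtain ⟨k, f, s, -, -, hfs⟩ := Module.Finite.exists_comp_eq_id_of_projective R A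
  let e := LinearEquiv.piRing R B (Fin k) R
  refine ⟨k, e.toLinearMap ∘ₗ f.lcomp R B, s.lcomp R B ∘ₗ e.symm.toLinearMap, ?_⟩
  ext φ x
  have : f (s x) = x := LinearMap.congr_fun hfs x
  simp [e, this]

end Ext


section RegularSequence

variable {A B D Y : Type u} [AddCommGroup A] [Module R A] [AddCommGroup B] [Module R B]
  [AddCommGroup D] [Module R D] [AddCommGroup Y] [Module R Y]

lemma IsShortExact.quotSMulTop_map {f : A →ₗ[R] B} {g : B →ₗ[R] D} (h : IsShortExact f g) {x : R}
    (hx : IsSMulRegular D x) : IsShortExact (QuotSMulTop.map x f) (QuotSMulTop.map x g) where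
  injective := by
    refine (LinearMap.exact_zero_iff_injective (QuotSMulTop x A) _).mp ?_
    have := QuotSMulTop.map_first_exact_on_four_term_exact_of_isSMulRegular_last
      ((LinearMap.exact_zero_iff_injective A f).mpr h.injective) h.exact hx
    rwa [map_zero] at this
  exact := QuotSMulTop.map_exact x h.exact h.surjective
  surjective := QuotSMulTop.map_surjective x h.surjective

lemma IsShortExact.isWeaklyRegular {f : A →ₗ[R] B} {g : B →ₗ[R] D} (h : IsShortExact f g)
    {rs : List R} (hB : IsWeaklyRegular B rs) (hD : IsWeaklyRegular D rs.dropLast) :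
    IsWeaklyRegular A rs := by
  induction rs generalizing A B D with
  | nil => exact .nil R A
  | cons x rs ih =>
    rw [isWeaklyRegular_cons_iff] at hB ⊢
    refine ⟨hB.1.of_injective f h.injective, ?_⟩
    cases rs with
    | nil => exact .nil R _
    | cons y rs =>
      rw [List.dropLast_cons_cons, isWeaklyRegular_cons_iff] at hD
      exact ih (h.quotSMulTop_map hD.1) hB.2 hD.2

lemma isWeaklyRegular_dropLast {rs : List R} (h : IsWeaklyRegular A rs) :
    IsWeaklyRegular A rs.dropLast := by
  obtain rfl | hrs := rs.eq_nil_or_concat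
  · exact h
  · obtain ⟨l, x, rfl⟩ := hrs
    rw [List.concat_eq_append] at h ⊢
    rw [List.dropLast_concat]
    exact ((isWeaklyRegular_append_iff _ _ _).mp h).1

lemma isWeaklyRegular_of_retract {s : A →ₗ[R] B} {r : B →ₗ[R] A} (hrs : r ∘ₗ s = LinearMap.id)
    {xs : List R} (hB : IsWeaklyRegular B xs) : IsWeaklyRegular A xs := by
  induction xs generalizing A B with
  | nil => exact .nil R A
  | cons x xs ih =>
    rw [isWeaklyRegular_cons_iff] at hB ⊢
    refine ⟨hB.1.of_injective s (Function.LeftInverse.injective (LinearMap.congr_fun hrs)),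
      ih (s := QuotSMulTop.map x s) (r := QuotSMulTop.map x r) ?_ hB.2⟩
    rw [← QuotSMulTop.map_comp, hrs, QuotSMulTop.map_id]

lemma IsSummandOfCopies.isWeaklyRegular (h : IsSummandOfCopies R A B) {rs : List R}
    (hA : IsWeaklyRegular A rs) : IsWeaklyRegular B rs := by
  obtain ⟨k, s, r, hrs⟩ := h
  exact isWeaklyRegular_of_retract hrs <|
    ((TensorProduct.piScalarRight R R A (Fin k)).isWeaklyRegular_congr rs).mp
      hA.isWeaklyRegular_rTensor

lemma ext_comp_lsmul (x : R) {i : ℕ} (e : Ext (ModuleCat.of R Y) (ModuleCat.of R A) i) :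
    e.comp (Ext.mk₀ (ModuleCat.ofHom (LinearMap.lsmul R A x))) (add_zero i) = x • e := by
  have h : ModuleCat.ofHom (LinearMap.lsmul R A x) = x • 𝟙 (ModuleCat.of R A) := rfl
  rw [h, Ext.mk₀_smul, Ext.comp_smul, Ext.comp_mk₀_id]

lemma lsmul_comp_ext (x : R) {i : ℕ} (e : Ext (ModuleCat.of R A) (ModuleCat.of R Y) i) :
    (Ext.mk₀ (ModuleCat.ofHom (LinearMap.lsmul R A x))).comp e (zero_add i) = x • e := by
  have h : ModuleCat.ofHom (LinearMap.lsmul R A x) = x • 𝟙 (ModuleCat.of R A) := rfl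
  rw [h, Ext.mk₀_smul, Ext.smul_comp, Ext.mk₀_id_comp]

lemma smul_ext_eq_zero {x : R} (hx : x ∈ Module.annihilator R A) {i : ℕ}
    (e : Ext (ModuleCat.of R A) (ModuleCat.of R Y) i) : x • e = 0 := by
  rw [← lsmul_comp_ext, Module.mem_annihilator_iff_lsmul_eq_zero.mp hx, ModuleCat.ofHom_zero,
    Ext.mk₀_zero, Ext.zero_comp]

lemma extVanishes_of_isWeaklyRegular {rs : List R} (hY : ∀ r ∈ rs, r ∈ Module.annihilator R Y)
    (hA : IsWeaklyRegular A rs) : ∀ i < rs.length, ExtVanishes R Y A i := by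
  induction rs generalizing A with
  | nil => simp
  | cons x rs ih =>
    rw [isWeaklyRegular_cons_iff] at hA
    have hx := hY x List.mem_cons_self
    rintro (_ | i) hi
    · exact extVanishes_zero_iff.mpr (hA.1.linearMap_subsingleton_of_mem_annihilator hx)
    have ih := ih (fun r hr => hY r (List.mem_cons_of_mem _ hr)) hA.2 i (by simpa using hi)
    refine extVanishes_of_forall_eq_zero fun e => ?_
    obtain ⟨y, rfl⟩ := Ext.covariant_sequence_exact₁ _ (isShortExact_lsmul_mkQ hA.1).shortExact e
      (by rw [ext_comp_lsmul, smul_ext_eq_zero hx]) rfl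
    exact (congrArg (Ext.comp · _ rfl) (ih.eq_zero y)).trans (Ext.zero_comp ..)

lemma extVanishes_quotSMulTop {x : R} (hx : IsSMulRegular A x) {i : ℕ} (h : ExtVanishes R Y A i)
    (h' : ExtVanishes R Y A (i + 1)) : ExtVanishes R Y (QuotSMulTop x A) i :=
  (isShortExact_lsmul_mkQ hx).extVanishes_covariant₃ h h'

lemma extVanishes_zero_quotient_ofList {rs : List R} (hA : IsWeaklyRegular A rs)
    (h : ∀ i ≤ rs.length, ExtVanishes R Y A i) :
    ExtVanishes R Y (A ⧸ (Ideal.ofList rs • ⊤ : Submodule R A)) 0 := by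
  induction rs generalizing A with
  | nil =>
    refine .of_equiv_right (Submodule.quotEquivOfEqBot _ ?_) (h 0 le_rfl)
    rw [Ideal.ofList_nil, Submodule.bot_smul]
  | cons x rs ih =>
    rw [isWeaklyRegular_cons_iff] at hA
    refine .of_equiv_right (Submodule.quotOfListConsSMulTopEquivQuotSMulTopInner A x rs)
      (ih hA.2 fun i hi => ?_)
    rw [List.length_cons] at h
    exact extVanishes_quotSMulTop hA.1 (h i (by omega)) (h (i + 1) (by omega))

lemma extVanishes_quotient_ofList {rs : List R} (hA : IsWeaklyRegular A rs) {b : ℕ}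
    (h : ∀ i, b < i → ExtVanishes R A Y i) {i : ℕ} (hi : b + rs.length < i) :
    ExtVanishes R (A ⧸ (Ideal.ofList rs • ⊤ : Submodule R A)) Y i := by
  induction rs generalizing A b with
  | nil =>
    refine .of_equiv_left (Submodule.quotEquivOfEqBot _ ?_) (h i hi)
    rw [Ideal.ofList_nil, Submodule.bot_smul]
  | cons x rs ih =>
    rw [isWeaklyRegular_cons_iff] at hA
    rw [List.length_cons] at hi
    refine .of_equiv_left (Submodule.quotOfListConsSMulTopEquivQuotSMulTopInner A x rs)
      (ih hA.2 (b := b + 1) (fun j hj => ?_) (by omega))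
    obtain ⟨j, rfl⟩ := Nat.exists_eq_add_one_of_ne_zero (by omega : j ≠ 0)
    exact (isShortExact_lsmul_mkQ hA.1).extVanishes_contravariant₃ (h j (by omega))
      (h (j + 1) (by omega))

end RegularSequence

section HomRegular

variable {C N : Type u} [AddCommGroup C] [Module R C] [AddCommGroup N] [Module R N]

lemma smul_top_linearMap_eq_ker {x : R} (hx : IsSMulRegular N x) :
    x • (⊤ : Submodule R (C →ₗ[R] N)) =
      LinearMap.ker ((x • ⊤ : Submodule R N).mkQ.compRight R : (C →ₗ[R] N) →ₗ[R] _) := by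
  have hN := isShortExact_lsmul_mkQ hx
  refine le_antisymm ?_ fun φ hφ => ?_
  · rintro _ ⟨φ, -, rfl⟩
    ext c
    exact hN.exact.apply_apply_eq_zero (φ c)
  · have hdiv (c : C) : φ c ∈ LinearMap.range (LinearMap.lsmul R N x) :=
      (hN.exact (φ c)).mp (LinearMap.congr_fun hφ c)
    let e := LinearEquiv.ofInjective (LinearMap.lsmul R N x) hN.injective
    refine ⟨e.symm.toLinearMap ∘ₗ φ.codRestrict _ hdiv, trivial, LinearMap.ext fun c => ?_⟩
    exact congrArg Subtype.val (e.apply_symm_apply ⟨φ c, hdiv c⟩)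

lemma nonempty_quotSMulTop_linearMap_equiv {x : R} (hx : IsSMulRegular N x)
    (hN : ExtVanishes R C N 1) :
    Nonempty (QuotSMulTop x (C →ₗ[R] N) ≃ₗ[R] (C →ₗ[R] QuotSMulTop x N)) :=
  ⟨(Submodule.quotEquivOfEq _ _ (smul_top_linearMap_eq_ker hx)).trans <|
    LinearMap.quotKerEquivOfSurjective _ ((isShortExact_lsmul_mkQ hx).exists_lift hN)⟩

lemma isSMulRegular_of_isSMulRegular_linearMap [IsNoetherianRing R] [Module.Finite R C]
    [Module.Finite R N] (hC : Module.annihilator R C = ⊥) {x : R}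
    (hx : IsSMulRegular (C →ₗ[R] N) x) : IsSMulRegular N x := by
  let K := LinearMap.ker (LinearMap.lsmul R N x)
  have hom_eq_zero (φ : C →ₗ[R] K) : φ = 0 := by
    have hxφ : x • (K.subtype ∘ₗ φ) = x • (0 : C →ₗ[R] N) := by
      ext c
      rw [smul_zero]
      exact (φ c).2
    ext c
    exact LinearMap.congr_fun (hx hxφ) c
  obtain ⟨r, hr, hrK⟩ := IsSMulRegular.subsingleton_linearMap_iff.mp
    (subsingleton_of_forall_eq 0 hom_eq_zero)
  rw [hC, Submodule.mem_bot] at hr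
  subst hr
  rw [isSMulRegular_iff_ker_lsmul_eq_bot]
  exact Submodule.subsingleton_iff_eq_bot.mp (IsSMulRegular.zero_iff_subsingleton.mp hrK)

lemma isWeaklyRegular_of_isWeaklyRegular_linearMap [IsNoetherianRing R] [Module.Finite R C]
    [Module.Finite R N] (hC : Module.annihilator R C = ⊥)
    (hN : ∀ i, 0 < i → ExtVanishes R C N i) {rs : List R}
    (h : IsWeaklyRegular (C →ₗ[R] N) rs) : IsWeaklyRegular N rs := by
  induction rs generalizing N with
  | nil => exact .nil R N
  | cons x rs ih =>
    rw [isWeaklyRegular_cons_iff] at h ⊢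
    have hx := isSMulRegular_of_isSMulRegular_linearMap hC h.1
    obtain ⟨e⟩ := nonempty_quotSMulTop_linearMap_equiv hx (hN 1 one_pos)
    exact ⟨hx, ih (fun i hi => extVanishes_quotSMulTop hx (hN i hi) (hN (i + 1) i.succ_pos))
      ((e.isWeaklyRegular_congr rs).mp h.2)⟩

lemma IsSemidualizing.annihilator_eq_bot (hC : IsSemidualizing R C) :
    Module.annihilator R C = ⊥ := by
  refine (Submodule.eq_bot_iff _).mpr fun r hr => hC.homothety_bijective.1 ?_
  ext c
  simpa using Module.mem_annihilator.mp hr c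

lemma IsSemidualizing.isWeaklyRegular [IsNoetherianRing R] (hC : IsSemidualizing R C)
    {rs : List R} (h : IsWeaklyRegular R rs) : IsWeaklyRegular C rs := by
  have := hC.finite
  have e : R ≃ₗ[R] (C →ₗ[R] C) :=
    .ofBijective (LinearMap.lsmul R C : R →ₗ[R] C →ₗ[R] C) hC.homothety_bijective
  exact isWeaklyRegular_of_isWeaklyRegular_linearMap hC.annihilator_eq_bot hC.ext_vanishes
    ((e.isWeaklyRegular_congr rs).mp h)

end HomRegular

section Depth

lemma SatisfiesS.le_depth {n : ℕ} (hS : SatisfiesS R n) {m : ℕ} (hmn : m ≤ n) (q : Ideal R)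
    [q.IsPrime] (hmq : (m : ℕ∞) ≤ q.height) :
    m ≤ depth (Localization.AtPrime q) (Localization.AtPrime q) := by
  have h := hS q
  rw [IsLocalization.AtPrime.ringKrullDim_eq_height q] at h
  have h' : min (n : ℕ∞) q.height ≤ depth (Localization.AtPrime q) (Localization.AtPrime q) :=
    WithBot.coe_le_coe.mp (by rwa [WithBot.coe_min])
  exact (le_min (by exact_mod_cast hmn) hmq).trans h'

variable [IsNoetherianRing R]

lemma depth_le_length_of_mem_associatedPrimes [IsLocalRing R] {N : Type u} [AddCommGroup N]
    [Module R N] {rs : List R} (hN : IsWeaklyRegular N rs)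
    (h : maximalIdeal R ∈ associatedPrimes R (N ⧸ (Ideal.ofList rs • ⊤ : Submodule R N))) :
    depth R N ≤ rs.length := by
  refine iSup₂_le fun ys ⟨hys, hNys⟩ => ?_
  by_contra! hlt
  have hlt : rs.length < ys.length := by exact_mod_cast hlt
  have hExt : ExtVanishes R (R ⧸ maximalIdeal R) (N ⧸ (Ideal.ofList rs • ⊤ : Submodule R N)) 0 :=
    extVanishes_zero_quotient_ofList hN fun i hi =>
      extVanishes_of_isWeaklyRegular (by simpa [Ideal.annihilator_quotient] using hys) hNys i
        (by omega)
  obtain ⟨-, f, hf⟩ := (isAssociatedPrime_iff_exists_injective_linearMap _ _).mp h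
  have := extVanishes_zero_iff.mp hExt
  exact not_subsingleton (R ⧸ maximalIdeal R) ⟨fun x y => hf (by simp [Subsingleton.elim f 0])⟩

open Module.associatedPrimes in
lemma depth_localization_le_length {rs : List R} (hrs : IsWeaklyRegular R rs) {q : Ideal R}
    [q.IsPrime] (hq : q ∈ associatedPrimes R (R ⧸ (Ideal.ofList rs • ⊤ : Submodule R R))) :
    depth (Localization.AtPrime q) (Localization.AtPrime q) ≤ rs.length := by
  let A := Localization.AtPrime q
  let rs' := rs.map (algebraMap R A)
  have hI : (Ideal.ofList rs • ⊤ : Ideal R).localized' A q.primeCompl (Algebra.linearMap R A) =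
      Ideal.ofList rs' • ⊤ := by
    rw [Ideal.localized'_eq_map, smul_eq_mul, Ideal.mul_top, smul_eq_mul, Ideal.mul_top,
      Ideal.map_ofList]
  have hmax : maximalIdeal A ∈ associatedPrimes A (A ⧸ (Ideal.ofList rs' • ⊤ : Ideal A)) := by
    rw [← hI]
    refine mem_associatedPrimes_of_comap_mem_associatedPrimes_of_isLocalizedModule
      q.primeCompl (Submodule.toLocalizedQuotient' A q.primeCompl (Algebra.linearMap R A) _) _ ?_
    rwa [← Ideal.under_def, Localization.AtPrime.under_maximalIdeal]
  simpa [rs'] using depth_le_length_of_mem_associatedPrimes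
    (hrs.of_isLocalization A q.primeCompl) hmax

lemma exists_isWeaklyRegular_concat {rs : List R} (hrs : IsWeaklyRegular R rs) {p : Ideal R}
    (hp : ∀ (q : Ideal R) [q.IsPrime], p ≤ q →
      rs.length < depth (Localization.AtPrime q) (Localization.AtPrime q)) :
    ∃ r ∈ p, IsWeaklyRegular R (rs ++ [r]) := by
  suffices h : Subsingleton (R ⧸ p →ₗ[R] R ⧸ (Ideal.ofList rs • ⊤ : Submodule R R)) by
    obtain ⟨r, hr, hreg⟩ := IsSMulRegular.subsingleton_linearMap_iff.mp h
    rw [Ideal.annihilator_quotient] at hr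
    refine ⟨r, hr, (isWeaklyRegular_append_iff _ _ _).mpr ⟨hrs, ?_⟩⟩
    exact (isWeaklyRegular_singleton_iff _ _).mpr hreg
  refine subsingleton_of_forall_eq 0 fun f => ?_
  by_contra hf
  have hf1 : f (Submodule.Quotient.mk 1) ≠ 0 := fun h1 =>
    hf (Submodule.linearMap_qext _ (LinearMap.ext_ring h1))
  obtain ⟨q, hq, hle⟩ := exists_le_isAssociatedPrime_of_isNoetherianRing R _ hf1
  have := hq.isPrime
  refine (hp q fun s hs => hle ?_).not_ge (depth_localization_le_length hrs hq)
  have hs1 : s • (Submodule.Quotient.mk 1 : R ⧸ p) = 0 :=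
    (Submodule.Quotient.mk_eq_zero p).mpr (by simpa using hs)
  rw [Submodule.mem_colon_singleton, Submodule.mem_bot, ← map_smul, hs1, map_zero]

lemma SatisfiesS.exists_isWeaklyRegular {n : ℕ} (hS : SatisfiesS R n) (p : Ideal R) {m : ℕ}
    (hmn : m ≤ n) (hmp : (m : ℕ∞) ≤ p.height) :
    ∃ rs : List R, rs.length = m ∧ (∀ r ∈ rs, r ∈ p) ∧ IsWeaklyRegular R rs := by
  induction m with
  | zero => exact ⟨[], rfl, by simp, .nil R R⟩
  | succ m ih =>
    obtain ⟨rs, rfl, hmem, hreg⟩ := ih (by omega) (le_trans (by exact_mod_cast Nat.le_succ m) hmp)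
    obtain ⟨r, hr, hreg'⟩ := exists_isWeaklyRegular_concat hreg (p := p) fun q _ hpq =>
      lt_of_lt_of_le (by exact_mod_cast Nat.lt_succ_self _)
        (hS.le_depth hmn q (hmp.trans (Ideal.height_mono hpq)))
    refine ⟨rs ++ [r], List.length_append, fun x hx => ?_, hreg'⟩
    rcases List.mem_append.mp hx with hx | hx
    · exact hmem x hx
    · exact List.mem_singleton.mp hx ▸ hr

end Depth

section IsLocalRing

variable [IsLocalRing R] {C N : Type u} [AddCommGroup C] [Module R C]
  [AddCommGroup N] [Module R N] {rs : List R}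

lemma eq_maximalIdeal_of_krullDimLE_zero_quotient {I q : Ideal R} [q.IsPrime] (hI : I ≤ q)
    [Ring.KrullDimLE 0 (R ⧸ I)] : q = maximalIdeal R := by
  have hq : (q.map (Ideal.Quotient.mk I)).IsPrime :=
    Ideal.map_isPrime_of_surjective Ideal.Quotient.mk_surjective (by rwa [Ideal.mk_ker])
  have hmax : (q.map (Ideal.Quotient.mk I)).IsMaximal := inferInstance
  have hcomap := Ideal.comap_isMaximal_of_surjective (Ideal.Quotient.mk I)
    Ideal.Quotient.mk_surjective (K := q.map (Ideal.Quotient.mk I))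
  rw [Ideal.comap_map_of_surjective' _ Ideal.Quotient.mk_surjective, Ideal.mk_ker,
    sup_eq_left.mpr hI] at hcomap
  exact eq_maximalIdeal hcomap

variable [IsNoetherianRing R]

lemma ExtVanishes.of_quotSMulTop [Module.Finite R C] [Module.Finite R N] {x : R}
    (hx : x ∈ maximalIdeal R) (hN : IsSMulRegular N x) {i : ℕ}
    (h : ExtVanishes R (QuotSMulTop x N) C (i + 1)) : ExtVanishes R N C i := by
  by_contra hne
  have := not_subsingleton_iff_nontrivial.mp hne
  refine Submodule.top_ne_pointwise_smul_of_mem_jacobson_annihilator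
    (M := Ext (ModuleCat.of R N) (ModuleCat.of R C) i) (maximalIdeal_le_jacobson _ hx)
    (eq_top_iff.mpr fun e _ => ?_).symm
  obtain ⟨y, rfl⟩ := Ext.contravariant_sequence_exact₁ (isShortExact_lsmul_mkQ hN).shortExact _ e
    (add_comm 1 i) (h.eq_zero _)
  exact ⟨y, trivial, (lsmul_comp_ext x y).symm⟩

lemma krullDimLE_zero_quotient_ofList (hmem : ∀ r ∈ rs, r ∈ maximalIdeal R)
    (hreg : IsWeaklyRegular R rs) (hdim : ringKrullDim R = rs.length) :
    Ring.KrullDimLE 0 (R ⧸ Ideal.ofList rs) := by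
  have hd := ringKrullDim_add_length_eq_ringKrullDim_of_isRegular rs
    ((isRegular_iff_isWeaklyRegular_of_subset_maximalIdeal hmem).mpr hreg)
  rw [hdim] at hd
  exact Ring.krullDimLE_iff.mpr (ENat.WithBot.add_natCast_cancel.mp (hd.trans (zero_add _).symm)).le

lemma exists_injective_residueField_quotient_ofList (hmem : ∀ r ∈ rs, r ∈ maximalIdeal R)
    (hreg : IsWeaklyRegular R rs) (hdim : ringKrullDim R = rs.length) :
    ∃ f : (R ⧸ maximalIdeal R) →ₗ[R] (R ⧸ (Ideal.ofList rs • ⊤ : Ideal R)),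
      Function.Injective f := by
  rw [smul_eq_mul, Ideal.mul_top]
  have : Ring.KrullDimLE 0 (R ⧸ Ideal.ofList rs) := krullDimLE_zero_quotient_ofList hmem hreg hdim
  have hle : Ideal.ofList rs ≤ maximalIdeal R := Ideal.span_le.mpr hmem
  have : Nontrivial (R ⧸ Ideal.ofList rs) :=
    Ideal.Quotient.nontrivial_iff.mpr fun h => (maximalIdeal.isMaximal R).ne_top
      (top_le_iff.mp (h ▸ hle))
  obtain ⟨q, hq⟩ := associatedPrimes.nonempty R (R ⧸ Ideal.ofList rs)
  obtain ⟨hqp, f, hf⟩ := (isAssociatedPrime_iff_exists_injective_linearMap _ _).mp hq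
  have hrs : Ideal.ofList rs ≤ q := by
    have := IsAssociatedPrime.annihilator_le hq
    rwa [Submodule.annihilator_top, Ideal.annihilator_quotient] at this
  obtain rfl := eq_maximalIdeal_of_krullDimLE_zero_quotient hrs
  exact ⟨f, hf⟩

lemma extVanishes_quotient_prime (p : Ideal R) [p.IsPrime] [Module.Finite R C]
    (hmem : ∀ r ∈ rs, r ∈ maximalIdeal R) (hreg : IsWeaklyRegular R rs)
    (hdim : ringKrullDim R = rs.length) {i : ℕ} (hi : rs.length < i)
    (h : ∀ (N : Type u) [AddCommGroup N] [Module R N] [Module.Finite R N],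
      ExtVanishes R N C (i + 1)) :
    ExtVanishes R (R ⧸ p) C i := by
  by_cases hp : p = maximalIdeal R
  · subst hp
    obtain ⟨f, hf⟩ := exists_injective_residueField_quotient_ofList hmem hreg hdim
    refine (isShortExact_mkQ_range hf).extVanishes_contravariant₁ ?_ (h _)
    exact extVanishes_quotient_ofList hreg (b := 0) (fun j hj => extVanishes_of_projective hj)
      (by omega)
  · obtain ⟨y, hy, hyp⟩ := SetLike.exists_of_lt ((le_maximalIdeal ‹p.IsPrime›.ne_top).lt_of_ne hp)
    have hreg : IsSMulRegular (R ⧸ p) y :=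
      (isSMulRegular_quotient_iff_mem_of_smul_mem p y).mpr fun x hx =>
        (‹p.IsPrime›.mem_or_mem hx).resolve_left hyp
    exact .of_quotSMulTop hy hreg (h _)

lemma extVanishes_of_length_lt [Module.Finite R C]
    (hC : injectiveDimension (ModuleCat.of R C) < ⊤)
    (hmem : ∀ r ∈ rs, r ∈ maximalIdeal R) (hreg : IsWeaklyRegular R rs)
    (hdim : ringKrullDim R = rs.length) [Module.Finite R N] {i : ℕ} (hi : rs.length < i) :
    ExtVanishes R N C i := by
  obtain ⟨T, hT⟩ := (injectiveDimension_ne_top_iff _).mp hC.ne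
  obtain ⟨k, hk⟩ : ∃ k, T + 1 ≤ i + k := ⟨T + 1, by omega⟩
  induction k generalizing i N with
  | zero => exact HasInjectiveDimensionLT.subsingleton _ _ i hk _
  | succ k ih =>
    refine IsNoetherianRing.induction_on_isQuotientEquivQuotientPrime R ‹Module.Finite R N›
      (motive := fun N _ _ _ => ExtVanishes R N C i) ?_ ?_ ?_
    · intro N _ _ _ _
      exact extVanishes_of_subsingleton i
    · intro N _ _ _ p e
      have := p.2
      exact .of_equiv_left e <| extVanishes_quotient_prime p.1 hmem hreg hdim hi
        fun _ _ _ _ => ih (by omega) (by omega)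
    · intro N₁ _ _ _ N₂ _ _ _ N₃ _ _ _ f g hf hg hfg h₁ h₃
      exact IsShortExact.extVanishes_contravariant₂ ⟨hf, hfg, hg⟩ h₁ h₃

lemma extVanishes_of_isWeaklyRegular_of_injectiveDimension [Module.Finite R C]
    (hC : injectiveDimension (ModuleCat.of R C) < ⊤)
    (hmem : ∀ r ∈ rs, r ∈ maximalIdeal R) (hreg : IsWeaklyRegular R rs)
    (hdim : ringKrullDim R = rs.length) [Module.Finite R N] (hN : IsWeaklyRegular N rs)
    {i : ℕ} (hi : 0 < i) : ExtVanishes R N C i := by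
  suffices H : ∀ ys : List R, (∀ r ∈ ys, r ∈ maximalIdeal R) → ∀ (N : Type u) [AddCommGroup N]
      [Module R N] [Module.Finite R N], IsWeaklyRegular N ys →
      ∀ i, rs.length < i + ys.length → ExtVanishes R N C i from
    H rs hmem N hN i (by omega)
  intro ys hys
  induction ys with
  | nil => exact fun N _ _ _ _ i hi => extVanishes_of_length_lt hC hmem hreg hdim hi
  | cons y ys ih =>
    intro N _ _ _ hN i hi
    rw [isWeaklyRegular_cons_iff] at hN
    rw [List.length_cons] at hi
    exact .of_quotSMulTop (hys y List.mem_cons_self) hN.1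
      (ih (fun r hr => hys r (List.mem_cons_of_mem _ hr)) _ hN.2 (i + 1) (by omega))

end IsLocalRing

section Localization

variable {A B D C N : Type u} [AddCommGroup A] [Module R A] [AddCommGroup B] [Module R B]
  [AddCommGroup D] [Module R D] [AddCommGroup C] [Module R C] [AddCommGroup N] [Module R N]
  (S : Submonoid R)

lemma IsShortExact.localizedModule_map {f : A →ₗ[R] B} {g : B →ₗ[R] D} (h : IsShortExact f g) :
    IsShortExact (LocalizedModule.map S f) (LocalizedModule.map S g) where
  injective := LocalizedModule.map_injective S f h.injective
  exact := LocalizedModule.map_exact S f g h.exact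
  surjective := LocalizedModule.map_surjective S g h.surjective

lemma exists_comp_eq_smul_of_localizedModule [Module.Finite R A] [Module.FinitePresentation R B]
    (f : A →ₗ[R] B) (φ : A →ₗ[R] C)
    (ψ : LocalizedModule S B →ₗ[Localization S] LocalizedModule S C)
    (hψ : ψ ∘ₗ LocalizedModule.map S f = LocalizedModule.map S φ) :
    ∃ (s : S) (χ : B →ₗ[R] C), χ ∘ₗ f = s • φ := by
  obtain ⟨χ, s, hχ⟩ := Module.FinitePresentation.exists_lift_of_isLocalizedModule S
    (LocalizedModule.mkLinearMap S C) (ψ.restrictScalars R ∘ₗ LocalizedModule.mkLinearMap S B)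
  obtain ⟨t, ht⟩ := Module.Finite.exists_smul_of_comp_eq_of_isLocalizedModule S
    (LocalizedModule.mkLinearMap S C) (χ ∘ₗ f) (s • φ) <| by
      ext a
      have hχa := LinearMap.congr_fun hχ (f a)
      have hψa := LinearMap.congr_fun hψ (LocalizedModule.mk a 1)
      simp only [LinearMap.coe_comp, Function.comp_apply, LocalizedModule.mkLinearMap_apply,
        LinearMap.smul_apply, LinearMap.coe_restrictScalars, LocalizedModule.map_mk,
        LinearMap.coe_smul, Pi.smul_apply, LinearMap.map_smul_of_tower] at hχa hψa ⊢
      rw [hχa, hψa]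
  exact ⟨t * s, t • χ, by rw [LinearMap.smul_comp, ht, mul_smul]⟩

lemma exists_smul_ext_eq_zero [IsNoetherianRing R] [Module.Finite R N] {i : ℕ}
    (h : ExtVanishes (Localization S) (LocalizedModule S N) (LocalizedModule S C) (i + 1))
    (e : Ext (ModuleCat.of R N) (ModuleCat.of R C) (i + 1)) : ∃ s ∈ S, s • e = 0 := by
  induction i generalizing N with
  | zero =>
    obtain ⟨k, g, hg⟩ := Module.Finite.exists_fin' R N
    have hseq := isShortExact_subtype_ker hg
    obtain ⟨φ, rfl⟩ := hseq.homConnecting_surjective (extVanishes_of_projective one_pos) e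
    obtain ⟨ψ, hψ⟩ := (hseq.localizedModule_map S).exists_extension h (LocalizedModule.map S φ)
    obtain ⟨s, χ, hχ⟩ := exists_comp_eq_smul_of_localizedModule S _ φ ψ hψ
    refine ⟨s, s.2, ?_⟩
    rw [← map_smul]
    exact hseq.homConnecting_eq_zero_iff.mpr ⟨χ, hχ⟩
  | succ i ih =>
    obtain ⟨k, g, hg⟩ := Module.Finite.exists_fin' R N
    have hseq := isShortExact_subtype_ker hg
    obtain ⟨e, rfl⟩ := hseq.extConnecting_surjective (extVanishes_of_projective i.succ.succ_pos) e
    have : Module.Projective (Localization S) (LocalizedModule S (Fin k → R)) :=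
      Module.projective_of_isLocalizedModule S (LocalizedModule.mkLinearMap S (Fin k → R))
    obtain ⟨s, hs, hse⟩ := ih ((hseq.localizedModule_map S).extVanishes_contravariant₁
      (extVanishes_of_projective i.succ_pos) h) e
    exact ⟨s, hs, by rw [← map_smul, hse, map_zero]⟩

end Localization

section Syzygy

variable {C M N X : Type u} [AddCommGroup C] [Module R C] [AddCommGroup M] [Module R M]
  [AddCommGroup N] [Module R N] [AddCommGroup X] [Module R X] {n : ℕ}

lemma isSyzygy_zero : IsSyzygy R 0 C M :=
  ⟨fun _ => ModuleCat.of R M, fun _ => 0, ⟨LinearEquiv.refl R M⟩, by omega, by omega, by omega⟩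

lemma IsSyzygy.of_equiv (e : M ≃ₗ[R] N) (h : IsSyzygy R n C N) : IsSyzygy R n C M := by
  obtain ⟨X, d, ⟨e'⟩, h⟩ := h
  exact ⟨X, d, ⟨e.trans e'⟩, h⟩

lemma IsSyzygy.succ {f : M →ₗ[R] X} {g : X →ₗ[R] N} (h : IsShortExact f g)
    (hX : IsSummandOfCopies R C X) (hN : IsSyzygy R n C N) : IsSyzygy R (n + 1) C M := by
  obtain ⟨Y, d, ⟨e⟩, hY, hd₀, hd⟩ := hN
  let Z : ℕ → ModuleCat.{u} R
    | 0 => ModuleCat.of R M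
    | 1 => ModuleCat.of R X
    | i + 2 => Y (i + 1)
  let δ : ∀ i, Z i →ₗ[R] Z (i + 1)
    | 0 => f
    | 1 => d 0 ∘ₗ e.toLinearMap ∘ₗ g
    | i + 2 => d (i + 1)
  refine ⟨Z, δ, ⟨LinearEquiv.refl R M⟩, ?_, fun _ => h.injective, ?_⟩
  · rintro (_ | _ | i) hi hin
    · omega
    · exact hX
    · exact hY (i + 1) (by omega) (by omega)
  · rintro (_ | _ | i) hi
    · exact h.exact.comp_injective _ ((hd₀ (by omega)).comp e.injective) (by simp)
    · have hsurj : Function.Surjective (e.toLinearMap ∘ₗ g) := e.surjective.comp h.surjective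
      exact hsurj.comp_exact_iff_exact.mpr (hd 0 (by omega))
    · exact hd (i + 1) (by omega)

lemma isSyzygy_cokernel {X : ℕ → ModuleCat.{u} R} {d : ∀ i, X i →ₗ[R] X (i + 1)}
    (hX : ∀ i, 1 ≤ i → i ≤ n + 1 → IsSummandOfCopies R C (X i))
    (hd : ∀ i < n, Function.Exact (d i) (d (i + 1))) :
    IsSyzygy R n C (X 1 ⧸ LinearMap.range (d 0)) := by
  cases n with
  | zero => exact isSyzygy_zero
  | succ n =>
  have hd₀ := hd 0 n.succ_pos
  let Z : ℕ → ModuleCat.{u} R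
    | 0 => ModuleCat.of R (X 1 ⧸ LinearMap.range (d 0))
    | i + 1 => X (i + 2)
  let δ : ∀ i, Z i →ₗ[R] Z (i + 1)
    | 0 => (LinearMap.range (d 0)).liftQ (d 1) hd₀.linearMap_ker_eq.ge
    | i + 1 => d (i + 2)
  refine ⟨Z, δ, ⟨LinearEquiv.refl R _⟩, ?_, fun _ => ?_, ?_⟩
  · rintro (_ | i) hi hin
    · omega
    · exact hX (i + 2) (by omega) (by omega)
  · exact LinearMap.ker_eq_bot.mp (Submodule.ker_liftQ_eq_bot' _ _ hd₀.linearMap_ker_eq.symm)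
  · rintro (_ | i) hi
    · exact (Submodule.mkQ_surjective _).comp_exact_iff_exact.mp (hd 1 (by omega))
    · exact hd (i + 2) (by omega)

lemma IsSyzygy.exists_isShortExact (h : IsSyzygy R (n + 1) C M) :
    ∃ (X N : ModuleCat.{u} R) (f : M →ₗ[R] X) (g : X →ₗ[R] N),
      IsShortExact f g ∧ IsSummandOfCopies R C X ∧ IsSyzygy R n C N := by
  obtain ⟨X, d, ⟨e⟩, hX, hd₀, hd⟩ := h
  refine ⟨X 1, ModuleCat.of R (X 1 ⧸ LinearMap.range (d 0)), d 0 ∘ₗ e.toLinearMap,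
    (LinearMap.range (d 0)).mkQ, ?_, hX 1 le_rfl (by omega),
    isSyzygy_cokernel hX fun i hi => hd i (by omega)⟩
  rw [← LinearEquiv.range_comp e (d 0)]
  exact isShortExact_mkQ_range ((hd₀ (by omega)).comp e.injective)

lemma IsSyzygy.isWeaklyRegular (hM : IsSyzygy R n C M) {rs : List R} (hlen : rs.length ≤ n)
    (hC : IsWeaklyRegular C rs) : IsWeaklyRegular M rs := by
  induction n generalizing M rs with
  | zero =>
    rw [List.length_eq_zero_iff.mp (Nat.le_zero.mp hlen)]
    exact .nil R M
  | succ n ih =>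
    obtain ⟨X, N, f, g, h, hX, hN⟩ := hM.exists_isShortExact
    exact h.isWeaklyRegular (hX.isWeaklyRegular hC)
      (ih hN (by rw [List.length_dropLast]; omega) (isWeaklyRegular_dropLast hC))

end Syzygy

section AcyclicPresentation

variable {A B D C Z : Type u} [AddCommGroup A] [Module R A] [AddCommGroup B] [Module R B]
  [AddCommGroup D] [Module R D] [AddCommGroup C] [Module R C] [AddCommGroup Z] [Module R Z]

lemma isShortExact_liftQ_mkQ {f : A →ₗ[R] B} {g : B →ₗ[R] D} (h : Function.Exact f g) :
    IsShortExact ((LinearMap.range f).liftQ g h.linearMap_ker_eq.ge) (LinearMap.range g).mkQ where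
  injective :=
    LinearMap.ker_eq_bot.mp (Submodule.ker_liftQ_eq_bot' _ _ h.linearMap_ker_eq.symm)
  exact := by rw [LinearMap.exact_iff, Submodule.ker_mkQ, Submodule.range_liftQ]
  surjective := Submodule.mkQ_surjective _

lemma exact_rangeRestrict {f : A →ₗ[R] B} {g : B →ₗ[R] D} (h : Function.Exact f g) :
    Function.Exact f g.rangeRestrict := by
  rw [LinearMap.exact_iff, LinearMap.ker_rangeRestrict, h.linearMap_ker_eq]

lemma exact_lcomp_of_extVanishes {f : A →ₗ[R] B} {g : B →ₗ[R] D} {ε : D →ₗ[R] Z}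
    (hfg : Function.Exact f g) (hgε : Function.Exact g ε) (hε : Function.Surjective ε)
    (hZ : ExtVanishes R Z C 1) : Function.Exact (g.lcomp R C) (f.lcomp R C) := by
  refine LinearMap.exact_iff.mpr (le_antisymm (fun φ hφ => ?_) ?_)
  · obtain ⟨ψ, rfl⟩ := (LinearMap.exact_lcomp_of_exact_of_surjective C (exact_rangeRestrict hfg)
      g.surjective_rangeRestrict φ).mp hφ
    obtain ⟨χ, rfl⟩ := (isShortExact_subtype_range hgε hε).exists_extension hZ ψ
    exact ⟨χ, rfl⟩
  · rintro _ ⟨χ, rfl⟩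
    ext a
    simp [hfg.apply_apply_eq_zero]

lemma exists_exact_finFun [IsNoetherianRing R] [Module.Finite R A] (f : A →ₗ[R] B) :
    ∃ (k : ℕ) (h : (Fin k → R) →ₗ[R] A), Function.Exact h f := by
  obtain ⟨k, g, hg⟩ := Module.Finite.exists_fin' R (LinearMap.ker f)
  refine ⟨k, (LinearMap.ker f).subtype ∘ₗ g, LinearMap.exact_iff.mpr ?_⟩
  rw [LinearMap.range_comp_of_range_eq_top _ (LinearMap.range_eq_top.mpr hg),
    Submodule.range_subtype]

variable (R C Z) in
/-- A presentation `X₁ → X₀ → Z → 0` with `Ext^i(X₁, C) = 0 = Ext^i(X₀, C)` for all `i > 0`. It is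
used both for the presentation of `Tr_C M` by the `C`-duals of projective modules and for
presentations of localizations of `M`. -/
structure AcyclicPresentation where
  X₁ : ModuleCat.{u} R
  X₀ : ModuleCat.{u} R
  finite₁ : Module.Finite R X₁
  extVanishes₁ : ∀ i, 0 < i → ExtVanishes R X₁ C i
  extVanishes₀ : ∀ i, 0 < i → ExtVanishes R X₀ C i
  d : X₁ →ₗ[R] X₀
  ε : X₀ →ₗ[R] Z
  exact : Function.Exact d ε
  surjective : Function.Surjective ε

namespace AcyclicPresentation

/-- The cokernel of `Hom(X₀, C) → Hom(X₁, C)`. -/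
abbrev transpose (π : AcyclicPresentation R C Z) : Type u :=
  (π.X₁ →ₗ[R] C) ⧸ LinearMap.range (π.d.lcomp R C)

/-- The presentation `R^k → X₁ → d(X₁) → 0` of the first syzygy of `Z` attached to a free cover
of the kernel of `d : X₁ → X₀`. -/
abbrev syzygy (π : AcyclicPresentation R C Z) {k : ℕ} {h : (Fin k → R) →ₗ[R] π.X₁}
    (hd : Function.Exact h π.d) : AcyclicPresentation R C (LinearMap.range π.d) where
  X₁ := ModuleCat.of R (Fin k → R)
  X₀ := π.X₁
  finite₁ := inferInstanceAs (Module.Finite R (Fin k → R))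
  extVanishes₁ _ hi := extVanishes_of_projective (A := Fin k → R) hi
  extVanishes₀ := π.extVanishes₁
  d := h
  ε := π.d.rangeRestrict
  exact := exact_rangeRestrict hd
  surjective := π.d.surjective_rangeRestrict

lemma extVanishes_range (π : AcyclicPresentation R C Z) {i : ℕ} (hi : 0 < i)
    (h : ExtVanishes R Z C (i + 1)) : ExtVanishes R (LinearMap.range π.d) C i :=
  (isShortExact_subtype_range π.exact π.surjective).extVanishes_contravariant₁
    (π.extVanishes₀ i hi) h

lemma exists_isShortExact_transpose_syzygy (π : AcyclicPresentation R C Z) {k : ℕ}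
    {h : (Fin k → R) →ₗ[R] π.X₁} (hd : Function.Exact h π.d) (hZ : ExtVanishes R Z C 1) :
    ∃ (f : π.transpose →ₗ[R] (Fin k → R) →ₗ[R] C) (g : _ →ₗ[R] (π.syzygy hd).transpose),
      IsShortExact f g :=
  ⟨_, _, isShortExact_liftQ_mkQ (exact_lcomp_of_extVanishes hd π.exact π.surjective hZ)⟩

lemma isSyzygy_transpose [IsNoetherianRing R] {n : ℕ} (π : AcyclicPresentation R C Z)
    (hZ : ∀ i, 1 ≤ i → i ≤ n → ExtVanishes R Z C i) : IsSyzygy R n C π.transpose := by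
  induction n generalizing Z with
  | zero => exact isSyzygy_zero
  | succ n ih =>
    have := π.finite₁
    obtain ⟨k, h, hd⟩ := exists_exact_finFun π.d
    obtain ⟨f, g, hfg⟩ := π.exists_isShortExact_transpose_syzygy hd (hZ 1 le_rfl (by omega))
    exact .succ hfg isSummandOfCopies_hom <| ih (π.syzygy hd) fun i hi hin =>
      π.extVanishes_range hi (hZ (i + 1) (by omega) (by omega))

end AcyclicPresentation

lemma eq_zero_of_extVanishes_zero_quotient {p : Ideal R} (hA : ExtVanishes R (R ⧸ p) A 0) {a : A}
    (ha : ∀ s ∈ p, s • a = 0) : a = 0 := by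
  have := extVanishes_zero_iff.mp hA
  let f : R ⧸ p →ₗ[R] A := Submodule.liftQ p (LinearMap.toSpanSingleton R A a) ha
  calc
    a = (1 : R) • a := (one_smul R a).symm
    _ = f (Submodule.Quotient.mk 1) := rfl
    _ = 0 := by rw [Subsingleton.elim f 0, LinearMap.zero_apply]

namespace AcyclicPresentation

lemma ext_one_eq_zero_of_smul_eq_zero (π : AcyclicPresentation R C Z) {p : Ideal R}
    (hT : ExtVanishes R (R ⧸ p) π.transpose 0) {e : Ext (ModuleCat.of R Z) (ModuleCat.of R C) 1}
    (he : ∀ s ∈ p, s • e = 0) : e = 0 := by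
  have hZ := isShortExact_subtype_range π.exact π.surjective
  obtain ⟨φ, rfl⟩ := hZ.homConnecting_surjective (π.extVanishes₀ 1 one_pos) e
  have mem_range {ψ : LinearMap.range π.d →ₗ[R] C} :
      ψ ∘ₗ π.d.rangeRestrict ∈ LinearMap.range (π.d.lcomp R C) ↔ hZ.homConnecting C ψ = 0 := by
    rw [hZ.homConnecting_eq_zero_iff, LinearMap.mem_range]
    refine exists_congr fun χ => ?_
    rw [← LinearMap.cancel_right π.d.surjective_rangeRestrict]
    rfl
  refine mem_range.mp ((Submodule.Quotient.mk_eq_zero _).mp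
    (eq_zero_of_extVanishes_zero_quotient hT fun s hs => ?_))
  rw [← Submodule.Quotient.mk_smul, Submodule.Quotient.mk_eq_zero, ← LinearMap.smul_comp, mem_range,
    map_smul, he s hs]

lemma ext_eq_zero_of_smul_eq_zero [IsNoetherianRing R] (π : AcyclicPresentation R C Z)
    {p : Ideal R} {rs : List R} (hmem : ∀ r ∈ rs, r ∈ p) (hC : IsWeaklyRegular C rs) {n : ℕ}
    (hn : n ≤ rs.length) (hT : ∀ i ≤ n, ExtVanishes R (R ⧸ p) π.transpose i)
    (hZ : ∀ i, 1 ≤ i → i ≤ n → ExtVanishes R Z C i)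
    {e : Ext (ModuleCat.of R Z) (ModuleCat.of R C) (n + 1)} (he : ∀ s ∈ p, s • e = 0) : e = 0 := by
  induction n generalizing Z with
  | zero => exact π.ext_one_eq_zero_of_smul_eq_zero (hT 0 le_rfl) he
  | succ n ih =>
    have hseq := isShortExact_subtype_range π.exact π.surjective
    obtain ⟨e, rfl⟩ := hseq.extConnecting_surjective (π.extVanishes₀ _ (by omega)) e
    have := π.finite₁
    obtain ⟨k, h, hd⟩ := exists_exact_finFun π.d
    obtain ⟨f, g, hfg⟩ := π.exists_isShortExact_transpose_syzygy hd (hZ 1 le_rfl (by omega))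
    have hfree : ∀ i < rs.length, ExtVanishes R (R ⧸ p) ((Fin k → R) →ₗ[R] C) i :=
      extVanishes_of_isWeaklyRegular (by simpa [Ideal.annihilator_quotient] using hmem)
        (isSummandOfCopies_hom.isWeaklyRegular hC)
    have he' : e = 0 := by
      refine ih (π.syzygy hd) (by omega) (fun i hi => ?_) (fun i hi hin => ?_) fun s hs => ?_
      · exact hfg.extVanishes_covariant₃ (hfree i (by omega)) (hT (i + 1) (by omega))
      · exact π.extVanishes_range hi (hZ (i + 1) (by omega) (by omega))
      · refine hseq.extConnecting_injective (π.extVanishes₀ _ (by omega)) ?_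
        rw [map_smul, he s hs, map_zero]
    rw [he', map_zero]

end AcyclicPresentation

end AcyclicPresentation

section Dual

variable {C M P : Type u} [AddCommGroup C] [Module R C] [AddCommGroup M] [Module R M]
  [AddCommGroup P] [Module R P]

lemma exists_sum_smul_eq_of_projective [Module.Finite R P] [Module.Projective R P] :
    ∃ (k : ℕ) (f : Fin k → P →ₗ[R] R) (b : Fin k → P), ∀ x, ∑ j, f j x • b j = x := by
  obtain ⟨k, r, s, -, -, hrs⟩ := Module.Finite.exists_comp_eq_id_of_projective R P
  refine ⟨k, fun j => LinearMap.proj j ∘ₗ s, fun j => r (Pi.single j 1), fun x => ?_⟩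
  calc
    _ = r (∑ j, s x j • Pi.single j 1) := by simp
    _ = x := by rw [← pi_eq_sum_univ', ← LinearMap.comp_apply, hrs, LinearMap.id_apply]

lemma IsSemidualizing.applyₗ_bijective (hC : IsSemidualizing R C) [Module.Finite R P]
    [Module.Projective R P] :
    Function.Bijective (LinearMap.applyₗ : P →ₗ[R] (P →ₗ[R] C) →ₗ[R] C) := by
  obtain ⟨k, f, b, hb⟩ := exists_sum_smul_eq_of_projective (R := R) (P := P)
  refine ⟨(injective_iff_map_eq_zero _).mpr fun x hx => ?_, fun Φ => ?_⟩
  · have hf : ∀ j, f j x = 0 := fun j => hC.homothety_bijective.1 <| by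
      ext c
      simpa using LinearMap.congr_fun hx (LinearMap.smulRight (f j) c)
    rw [← hb x]
    simp [hf]
  · choose a ha using fun j =>
      hC.homothety_bijective.2 (Φ ∘ₗ (LinearMap.smulRightₗ (f j) : C →ₗ[R] P →ₗ[R] C))
    refine ⟨∑ j, a j • b j, LinearMap.ext fun φ => ?_⟩
    have hφ : ∑ j, LinearMap.smulRightₗ (f j) (φ (b j)) = φ := by
      ext x
      conv_rhs => rw [← hb x]
      simp
    calc
      φ (∑ j, a j • b j) = ∑ j, LinearMap.lsmul R C (a j) (φ (b j)) := by simp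
      _ = Φ (∑ j, LinearMap.smulRightₗ (f j) (φ (b j))) := by simp [ha]
      _ = Φ φ := by rw [hφ]

namespace ProjPresentation

attribute [local instance] finite₁ finite₀ projective₁ projective₀

variable [IsNoetherianRing R] (π : ProjPresentation R M) (hC : IsSemidualizing R C)

include hC in
lemma finite_transpose : Module.Finite R (π.transpose C) := by
  have := hC.finite
  infer_instance

/-- The presentation `Hom(P₀, C) → Hom(P₁, C) → Tr_C M → 0`. -/
abbrev dual : AcyclicPresentation R C (π.transpose C) where
  X₁ := ModuleCat.of R (π.P₀ →ₗ[R] C)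
  X₀ := ModuleCat.of R (π.P₁ →ₗ[R] C)
  finite₁ :=
    have := hC.finite
    inferInstanceAs (Module.Finite R (π.P₀ →ₗ[R] C))
  extVanishes₁ i hi := isSummandOfCopies_hom.extVanishes_left (hC.ext_vanishes i hi)
  extVanishes₀ i hi := isSummandOfCopies_hom.extVanishes_left (hC.ext_vanishes i hi)
  d := π.d.lcomp R C
  ε := Submodule.mkQ _
  exact := LinearMap.exact_map_mkQ_range _
  surjective := Submodule.mkQ_surjective _

lemma nonempty_dual_transpose_equiv : Nonempty ((π.dual hC).transpose ≃ₗ[R] M) := by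
  let e : π.P₀ ≃ₗ[R] (π.P₀ →ₗ[R] C) →ₗ[R] C := .ofBijective _ hC.applyₗ_bijective
  have he : (LinearMap.ker π.ε).map e.toLinearMap =
      LinearMap.range ((π.d.lcomp R C).lcomp R C) := by
    rw [π.exact.linearMap_ker_eq, ← LinearMap.range_comp]
    have hd : e.toLinearMap ∘ₗ π.d = (π.d.lcomp R C).lcomp R C ∘ₗ LinearMap.applyₗ := rfl
    rw [hd, LinearMap.range_comp_of_range_eq_top _
      (LinearMap.range_eq_top.mpr hC.applyₗ_bijective.2)]
  exact ⟨(Submodule.Quotient.equiv _ _ e he).symm.trans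
    (π.ε.quotKerEquivOfSurjective π.surjective)⟩

end ProjPresentation

lemma IsTorsionfree.isSyzygy [IsNoetherianRing R] {n : ℕ} (hC : IsSemidualizing R C)
    (h : IsTorsionfree R n C M) : IsSyzygy R n C M := by
  obtain ⟨π, hπ⟩ := h
  obtain ⟨e⟩ := π.nonempty_dual_transpose_equiv hC
  exact ((π.dual hC).isSyzygy_transpose hπ).of_equiv e.symm

lemma ProjPresentation.ext_transpose_eq_zero_of_smul_eq_zero [IsNoetherianRing R]
    (π : ProjPresentation R M) (hC : IsSemidualizing R C) {p : Ideal R} {rs : List R}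
    (hmem : ∀ r ∈ rs, r ∈ p) (hR : IsWeaklyRegular R rs) (hM : IsWeaklyRegular M rs) {n : ℕ}
    (hn : n < rs.length) (hT : ∀ i, 1 ≤ i → i ≤ n → ExtVanishes R (π.transpose C) C i)
    {e : Ext (ModuleCat.of R (π.transpose C)) (ModuleCat.of R C) (n + 1)}
    (he : ∀ s ∈ p, s • e = 0) : e = 0 := by
  obtain ⟨f⟩ := π.nonempty_dual_transpose_equiv hC
  refine (π.dual hC).ext_eq_zero_of_smul_eq_zero hmem (hC.isWeaklyRegular hR) hn.le
    (fun i hi => .of_equiv_right f ?_) hT he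
  exact extVanishes_of_isWeaklyRegular (by simpa [Ideal.annihilator_quotient] using hmem) hM i
    (by omega)

end Dual

section Localization

variable {A B C M N : Type u} [AddCommGroup A] [Module R A] [AddCommGroup B] [Module R B]
  [AddCommGroup C] [Module R C] [AddCommGroup M] [Module R M] [AddCommGroup N] [Module R N]
  (S : Submonoid R)

lemma localized'_range_lcomp [Module.FinitePresentation R A] [Module.FinitePresentation R B]
    (f : A →ₗ[R] B) :
    (LinearMap.range (f.lcomp R C)).localized' (Localization S) S (LocalizedModule.map S) =
      LinearMap.range ((LocalizedModule.map S f).lcomp (Localization S) (LocalizedModule S C)) := by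
  have hf : IsLocalizedModule.map S (LocalizedModule.map S) (LocalizedModule.map S)
        (f.lcomp R C) =
      ((LocalizedModule.map S f).lcomp (Localization S) (LocalizedModule S C)).restrictScalars
        R := by
    refine IsLocalizedModule.linearMap_ext S (LocalizedModule.map S) (LocalizedModule.map S) ?_
    rw [IsLocalizedModule.map_comp]
    ext φ x
    induction x using LocalizedModule.induction_on with
    | _ a s => simp [LocalizedModule.map_mk]
  rw [LinearMap.localized'_range_eq_range_localizedMap (Localization S) S (LocalizedModule.map S)]
  congr 1
  ext1 φ
  exact LinearMap.congr_fun hf φ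

lemma nonempty_localizedModule_quotient_equiv [Module (Localization S) N]
    [IsScalarTower R (Localization S) N] (f : M →ₗ[R] N) [IsLocalizedModule S f]
    (q : Submodule R M) : Nonempty (LocalizedModule S (M ⧸ q) ≃ₗ[Localization S]
      N ⧸ q.localized' (Localization S) S f) :=
  ⟨(IsLocalizedModule.iso S
    (q.toLocalizedQuotient' (Localization S) S f)).extendScalarsOfIsLocalization S _⟩

namespace ProjPresentation

attribute [local instance] finite₁ finite₀ projective₁ projective₀

/-- The localization at `S` of a presentation of `M`, viewed as an acyclic presentation with
respect to the localization of `C`. -/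
noncomputable abbrev localized (π : ProjPresentation R M) (C : Type u) [AddCommGroup C]
    [Module R C] :
    AcyclicPresentation (Localization S) (LocalizedModule S C) (LocalizedModule S M) where
  X₁ := ModuleCat.of _ (LocalizedModule S π.P₁)
  X₀ := ModuleCat.of _ (LocalizedModule S π.P₀)
  finite₁ := Module.Finite.of_isLocalizedModule S (LocalizedModule.mkLinearMap S π.P₁)
  extVanishes₁ _ hi :=
    have := Module.projective_of_isLocalizedModule (Rₛ := Localization S) S
      (LocalizedModule.mkLinearMap S π.P₁)
    extVanishes_of_projective hi
  extVanishes₀ _ hi :=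
    have := Module.projective_of_isLocalizedModule (Rₛ := Localization S) S
      (LocalizedModule.mkLinearMap S π.P₀)
    extVanishes_of_projective hi
  d := LocalizedModule.map S π.d
  ε := LocalizedModule.map S π.ε
  exact := LocalizedModule.map_exact S π.d π.ε π.exact
  surjective := LocalizedModule.map_surjective S π.ε π.surjective

lemma nonempty_localizedModule_transpose_equiv (π : ProjPresentation R M) :
    Nonempty (LocalizedModule S (π.transpose C) ≃ₗ[Localization S]
      (π.localized S C).transpose) := by
  have := Module.finitePresentation_of_projective R π.P₀
  have := Module.finitePresentation_of_projective R π.P₁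
  have h := nonempty_localizedModule_quotient_equiv S (LocalizedModule.map S)
    (LinearMap.range (π.d.lcomp R C))
  rwa [localized'_range_lcomp] at h

end ProjPresentation

variable {p : Ideal R} [p.IsPrime] {rs : List R}

lemma extVanishes_localizedModule_of_isWeaklyRegular [IsNoetherianRing R] [Module.Finite R C]
    (hC : injectiveDimension (ModuleCat.of (Localization.AtPrime p)
      (LocalizedModule p.primeCompl C)) < ⊤)
    (hmem : ∀ r ∈ rs, r ∈ p) (hR : IsWeaklyRegular R rs) (hp : p.height = rs.length)
    [Module.Finite R N] (hN : IsWeaklyRegular (LocalizedModule p.primeCompl N)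
      (rs.map (algebraMap R (Localization.AtPrime p)))) {i : ℕ} (hi : 0 < i) :
    ExtVanishes (Localization.AtPrime p) (LocalizedModule p.primeCompl N)
      (LocalizedModule p.primeCompl C) i := by
  refine extVanishes_of_isWeaklyRegular_of_injectiveDimension hC ?_
    (hR.of_isLocalization _ p.primeCompl) ?_ hN hi
  · simpa only [List.forall_mem_map, IsLocalization.AtPrime.to_map_mem_maximal_iff _ p] using hmem
  · rw [IsLocalization.AtPrime.ringKrullDim_eq_height p, hp, List.length_map]
    rfl

lemma ProjPresentation.extVanishes_localizedModule_transpose [IsNoetherianRing R]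
    (π : ProjPresentation R M) [Module.Finite R M] (hC : IsSemidualizing R C)
    (hCp : injectiveDimension (ModuleCat.of (Localization.AtPrime p)
      (LocalizedModule p.primeCompl C)) < ⊤)
    (hmem : ∀ r ∈ rs, r ∈ p) (hR : IsWeaklyRegular R rs) (hp : p.height = rs.length)
    (hM : IsWeaklyRegular M rs) {i : ℕ} (hi : 0 < i) :
    ExtVanishes (Localization.AtPrime p) (LocalizedModule p.primeCompl (π.transpose C))
      (LocalizedModule p.primeCompl C) i := by
  have := hC.finite
  have := π.finite_transpose hC
  refine extVanishes_localizedModule_of_isWeaklyRegular hCp hmem hR hp ?_ hi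
  have hMp : ∀ i, 1 ≤ i → i ≤ rs.length → ExtVanishes (Localization.AtPrime p)
      (LocalizedModule p.primeCompl M) (LocalizedModule p.primeCompl C) i := fun i hi _ =>
    extVanishes_localizedModule_of_isWeaklyRegular hCp hmem hR hp
      (hM.of_isLocalizedModule _ p.primeCompl (LocalizedModule.mkLinearMap _ M)) hi
  obtain ⟨e⟩ := π.nonempty_localizedModule_transpose_equiv (C := C) p.primeCompl
  exact (((π.localized p.primeCompl C).isSyzygy_transpose hMp).of_equiv e).isWeaklyRegular
    (by rw [List.length_map]) ((hC.isWeaklyRegular hR).of_isLocalizedModule _ p.primeCompl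
      (LocalizedModule.mkLinearMap _ C))

end Localization

section Torsionfree

variable {C M : Type u} [AddCommGroup C] [Module R C] [AddCommGroup M] [Module R M]
  [IsNoetherianRing R]

lemma nonempty_projPresentation [Module.Finite R M] : Nonempty (ProjPresentation R M) := by
  obtain ⟨k, g, hg⟩ := Module.Finite.exists_fin' R M
  obtain ⟨l, f, hfg⟩ := exists_exact_finFun g
  exact ⟨{
    P₁ := ModuleCat.of R (Fin l → R)
    P₀ := ModuleCat.of R (Fin k → R)
    finite₁ := inferInstanceAs (Module.Finite R (Fin l → R))
    finite₀ := inferInstanceAs (Module.Finite R (Fin k → R))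
    projective₁ := inferInstanceAs (Module.Projective R (Fin l → R))
    projective₀ := inferInstanceAs (Module.Projective R (Fin k → R))
    d := f
    ε := g
    exact := hfg
    surjective := hg }⟩

lemma extVanishes_of_forall_isPrime {i : ℕ}
    (h : ∀ (p : Ideal R) [p.IsPrime] (e : Ext (ModuleCat.of R M) (ModuleCat.of R C) i),
      (∀ s, s ∈ p ↔ s • e = 0) → e = 0) : ExtVanishes R M C i := by
  by_contra hne
  have := not_subsingleton_iff_nontrivial.mp hne
  obtain ⟨p, hp⟩ := associatedPrimes.nonempty R (Ext (ModuleCat.of R M) (ModuleCat.of R C) i)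
  obtain ⟨hp, e, hpe⟩ := isAssociatedPrime_iff.mp hp
  have he (s : R) : s ∈ p ↔ s • e = 0 := by
    rw [hpe, Submodule.mem_colon_singleton, Submodule.mem_bot]
  exact hp.ne_top ((Ideal.eq_top_iff_one p).mpr ((he 1).mpr (by rw [h p e he, smul_zero])))

lemma ProjPresentation.extVanishes_transpose (π : ProjPresentation R M) [Module.Finite R M]
    {n : ℕ} (hC : IsSemidualizing R C) (hS : SatisfiesS R n) (hG : SatisfiesG R ((n : ℤ) - 1) C)
    (hM : ∀ rs : List R, rs.length ≤ n → IsWeaklyRegular R rs → IsWeaklyRegular M rs)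
    {i : ℕ} (hi : i + 1 ≤ n) : ExtVanishes R (π.transpose C) C (i + 1) := by
  induction i using Nat.strong_induction_on with
  | _ i ih =>
  refine extVanishes_of_forall_isPrime fun p _ e he => ?_
  rcases le_or_gt ((i + 1 : ℕ) : ℕ∞) p.height with hle | hlt
  · obtain ⟨rs, hlen, hmem, hreg⟩ := hS.exists_isWeaklyRegular p hi hle
    refine π.ext_transpose_eq_zero_of_smul_eq_zero hC hmem hreg (hM rs (by omega) hreg)
      (by omega) (fun j hj hji => ?_) fun s hs => (he s).mp hs
    obtain ⟨j, rfl⟩ := Nat.exists_eq_add_of_le' hj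
    exact ih j (by omega) (by omega)
  · obtain ⟨h, hh⟩ := ENat.ne_top_iff_exists.mp (ne_top_of_lt hlt)
    have hhi : h < i + 1 := by exact_mod_cast hh.trans_lt hlt
    obtain ⟨rs, rfl, hmem, hreg⟩ := hS.exists_isWeaklyRegular p (by omega) hh.le
    have := hC.finite
    have := π.finite_transpose hC
    obtain ⟨s, hs, hse⟩ := exists_smul_ext_eq_zero p.primeCompl
      (π.extVanishes_localizedModule_transpose hC (hG p _ hh.symm (by omega)) hmem hreg hh.symm
        (hM rs (by omega) hreg) i.succ_pos) e
    exact absurd ((he s).mpr hse) hs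

lemma isTorsionfree_of_isWeaklyRegular [Module.Finite R M] {n : ℕ} (hC : IsSemidualizing R C)
    (hS : SatisfiesS R n) (hG : SatisfiesG R ((n : ℤ) - 1) C)
    (hM : ∀ rs : List R, rs.length ≤ n → IsWeaklyRegular R rs → IsWeaklyRegular M rs) :
    IsTorsionfree R n C M := by
  obtain ⟨π⟩ := nonempty_projPresentation (R := R) (M := M)
  refine ⟨π, fun i hi hin => ?_⟩
  obtain ⟨i, rfl⟩ := Nat.exists_eq_add_of_le' hi
  exact π.extVanishes_transpose hC hS hG hM hin

end Torsionfree

end SemidualizingTorsion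

theorem corollary3p2 {R : Type u} [CommRing R] [IsNoetherianRing R] (n : ℕ)
    (C C' : Type u) [AddCommGroup C] [Module R C] [AddCommGroup C'] [Module R C']
    (hC : SemidualizingTorsion.IsSemidualizing R C)
    (hC' : SemidualizingTorsion.IsSemidualizing R C')
    (hS : SemidualizingTorsion.SatisfiesS R n)
    (hG : SemidualizingTorsion.SatisfiesG R ((n : ℤ) - 1) C)
    (hG' : SemidualizingTorsion.SatisfiesG R ((n : ℤ) - 1) C')
    (M : Type u) [AddCommGroup M] [Module R M] [Module.Finite R M] :
    List.TFAE
      [SemidualizingTorsion.IsTorsionfree R n C M,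
       SemidualizingTorsion.IsTorsionfree R n C' M,
       SemidualizingTorsion.IsSyzygy R n C M,
       SemidualizingTorsion.IsSyzygy R n C' M] := by
  tfae_have 1 → 3 := fun h => h.isSyzygy hC
  tfae_have 2 → 4 := fun h => h.isSyzygy hC'
  tfae_have 3 → 2 := fun h =>
    SemidualizingTorsion.isTorsionfree_of_isWeaklyRegular hC' hS hG' fun _ hlen hreg =>
      h.isWeaklyRegular hlen (hC.isWeaklyRegular hreg)
  tfae_have 4 → 1 := fun h =>
    SemidualizingTorsion.isTorsionfree_of_isWeaklyRegular hC hS hG fun _ hlen hreg =>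
      h.isWeaklyRegular hlen (hC'.isWeaklyRegular hreg)
  tfae_finish
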